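/- Let $K$ be a field. For $n\in\{1,2,3,\dots\}\cup\{\infty\}$ let $L_K(1,n)$ be the Leavitt algebra, i.e. the Leavitt path algebra of the rose $R_n$ with one vertex $v$ and $n$ loops (countably infinitely many loops if $n=\infty$). Explicitly, $L_K(1,n)$ is the associative $K$-algebra generated by $v$ and elements $e_i,e_i^*$ (where $1\le i\le n$, and $i$ ranges over all positive integers if $n=\infty$), subject to the relations that $v$ is a two-sided identity, that $e_i^*e_j=\delta_{ij}v$ for all $i,j$, and, only if $n$ is finite, that $\sum_{i=1}^n e_ie_i^*=v$. (Thus $L_K(1,1)\cong K[x,x^{-1}]$.) For a ring $R$ let $\mathbb{M}_m(R)$ be the ring of $m\times m$ matrices over $R$ if $m$ is finite, and let $\mathbb{M}_\infty(R)$ be the ring of matrices over $R$, with rows and columns indexed by a countably infinite set, that have only finitely many nonzero entries. Then for all $m\in\{0,1,2,\dots\}\cup\{\infty\}$ (where $\mathbb{M}_0$ is the zero ring) and all $n\in\{1,2,3,\dots\}\cup\{\infty\}$, $$\operatorname{Soc}\bigl(\mathbb{M}_m(L_K(1,n))\bigr)=0,$$ that is, both the sum of all minimal left ideals and the sum of all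 minimal right ideals of $\mathbb{M}_m(L_K(1,n))$ are zero. Here a minimal left (right) ideal is a nonzero left (right) ideal that is minimal among the nonzero left (right) ideals. -/

import Mathlib

/-! ### Directed graphs -/

/-- A directed graph, given by its vertices, its edges and the source and range maps. Loops and
multiple edges are allowed. -/
structure DirectedGraph where
  Vertex : Type
  Edge : Type
  source : Edge → Vertex
  range : Edge → Vertex

namespace DirectedGraph

/-- A vertex is regular if it is neither a sink nor an infinite emitter: the set of edges that it
emits is finite and nonempty. -/
def IsRegular (E : DirectedGraph) (v : E.Vertex) : Prop :=
  {e : E.Edge | E.source e = v}.Finite ∧ {e : E.Edge | E.source e = v}.Nonempty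

end DirectedGraph

/-- The standard index set with `n` elements: the natural numbers `i < n`. It is all of `ℕ` when
`n = ∞`. -/
abbrev InitialSegment (n : ℕ∞) : Type := {i : ℕ // (i : ℕ∞) < n}

/-- The rose with `n` petals: one vertex and `n` loops at it (countably many if `n = ∞`). -/
def roseGraph (n : ℕ∞) : DirectedGraph where
  Vertex := Unit
  Edge := InitialSegment n
  source _ := ()
  range _ := ()

/-! ### Leavitt path algebras -/

/-- The generators of a Leavitt path algebra: vertices, (real) edges and ghost edges. -/
inductive LeavittGenerator (E : DirectedGraph) : Type
  | vertex (v : E.Vertex) : LeavittGenerator E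
  | edge (e : E.Edge) : LeavittGenerator E
  | ghost (e : E.Edge) : LeavittGenerator E

/-- The free associative (not unital) `K`-algebra on the generators: its `K`-basis is the set of
nonempty words. A unit must not be adjoined here, since the vertices alone provide the local
units of the Leavitt path algebra. -/
abbrev FreeLeavittAlgebra (K : Type*) [Field K] (E : DirectedGraph) : Type _ :=
  MonoidAlgebra K (FreeSemigroup (LeavittGenerator E))

namespace FreeLeavittAlgebra

variable (K : Type*) [Field K] {E : DirectedGraph}

/-- A generator as an element of the free algebra. -/
noncomputable def gen (x : LeavittGenerator E) : FreeLeavittAlgebra K E :=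
  MonoidAlgebra.single (FreeSemigroup.of x) 1

/-- A vertex as an element of the free algebra. -/
noncomputable def vertex (v : E.Vertex) : FreeLeavittAlgebra K E := gen K (.vertex v)

/-- An edge `e` as an element of the free algebra. -/
noncomputable def edge (e : E.Edge) : FreeLeavittAlgebra K E := gen K (.edge e)

/-- The ghost edge `e*` as an element of the free algebra. -/
noncomputable def ghost (e : E.Edge) : FreeLeavittAlgebra K E := gen K (.ghost e)

end FreeLeavittAlgebra

open FreeLeavittAlgebra in
/-- The defining relations of the Leavitt path algebra. -/
inductive LeavittRel (K : Type*) [Field K] (E : DirectedGraph) :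
    FreeLeavittAlgebra K E → FreeLeavittAlgebra K E → Prop
  /-- Vertices are idempotent. -/
  | vertex_mul_self (v : E.Vertex) : LeavittRel K E (vertex K v * vertex K v) (vertex K v)
  /-- Distinct vertices are orthogonal. -/
  | vertex_mul_of_ne (v w : E.Vertex) (h : v ≠ w) : LeavittRel K E (vertex K v * vertex K w) 0
  /-- `s(e) e = e`. -/
  | source_mul_edge (e : E.Edge) : LeavittRel K E (vertex K (E.source e) * edge K e) (edge K e)
  /-- `e r(e) = e`. -/
  | edge_mul_range (e : E.Edge) : LeavittRel K E (edge K e * vertex K (E.range e)) (edge K e)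
  /-- `r(e) e* = e*`. -/
  | range_mul_ghost (e : E.Edge) : LeavittRel K E (vertex K (E.range e) * ghost K e) (ghost K e)
  /-- `e* s(e) = e*`. -/
  | ghost_mul_source (e : E.Edge) : LeavittRel K E (ghost K e * vertex K (E.source e)) (ghost K e)
  /-- `e* e = r(e)`. -/
  | ghost_mul_edge_self (e : E.Edge) :
      LeavittRel K E (ghost K e * edge K e) (vertex K (E.range e))
  /-- `e* f = 0` for distinct edges `e` and `f`. -/
  | ghost_mul_edge_of_ne (e f : E.Edge) (h : e ≠ f) : LeavittRel K E (ghost K e * edge K f) 0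
  /-- `v = ∑ e e*`, over the edges `e` with source `v`, for every regular vertex `v`. -/
  | vertex_eq_sum (v : E.Vertex) (h : E.IsRegular v) :
      LeavittRel K E (vertex K v) (∑ e ∈ h.1.toFinset, edge K e * ghost K e)

/-- The scalar multiples of the defining relations. As there is no unit, they have to be added
so that the ring congruence that they generate is compatible with scalars. -/
def LeavittScalarRel (K : Type*) [Field K] (E : DirectedGraph)
    (x y : FreeLeavittAlgebra K E) : Prop :=
  ∃ (c : K) (a b : FreeLeavittAlgebra K E), LeavittRel K E a b ∧ x = c • a ∧ y = c • b

/-- The congruence on the free algebra generated by the defining relations. -/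
noncomputable def leavittCon (K : Type*) [Field K] (E : DirectedGraph) : RingCon (FreeLeavittAlgebra K E) :=
  ringConGen (LeavittScalarRel K E)

/-- The Leavitt path algebra `L_K(E)`: the free associative `K`-algebra on the vertices, edges and
ghost edges, modulo the defining relations. -/
def LeavittPathAlgebra (K : Type*) [Field K] (E : DirectedGraph) : Type _ :=
  (leavittCon K E).Quotient

namespace LeavittPathAlgebra

variable (K : Type*) [Field K] (E : DirectedGraph)

noncomputable instance instNonUnitalRing : NonUnitalRing (LeavittPathAlgebra K E) :=
  inferInstanceAs (NonUnitalRing (leavittCon K E).Quotient)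

variable {K E} in
theorem leavittCon_smul (c : K) {x y : FreeLeavittAlgebra K E} (h : leavittCon K E x y) :
    leavittCon K E (c • x) (c • y) := by
  change RingConGen.Rel _ _ _ at h
  change RingConGen.Rel _ _ _
  induction h generalizing c with
  | of x y h =>
    obtain ⟨d, a, b, hab, rfl, rfl⟩ := h
    exact .of _ _ ⟨c * d, a, b, hab, by rw [mul_smul], by rw [mul_smul]⟩
  | refl x => exact .refl _
  | symm _ ih => exact .symm (ih c)
  | trans _ _ ih₁ ih₂ => exact .trans (ih₁ c) (ih₂ c)
  | add _ _ ih₁ ih₂ => rw [smul_add, smul_add]; exact .add (ih₁ c) (ih₂ c)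
  | mul _ h₂ ih₁ _ =>
    rw [← smul_mul_assoc, ← smul_mul_assoc]
    exact .mul (ih₁ c) h₂

/-- The quotient map from the free algebra. -/
noncomputable def mk : FreeLeavittAlgebra K E →ₙ+* LeavittPathAlgebra K E where
  toFun x := (leavittCon K E).toQuotient x
  map_mul' _ _ := rfl
  map_zero' := rfl
  map_add' _ _ := rfl

theorem mk_surjective : Function.Surjective (mk K E) := Quotient.mk''_surjective

noncomputable instance instSMul : SMul K (LeavittPathAlgebra K E) where
  smul c := Quotient.map' (fun x => c • x) fun _ _ h => leavittCon_smul c h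

theorem mk_smul (c : K) (x : FreeLeavittAlgebra K E) : mk K E (c • x) = c • mk K E x := rfl

noncomputable instance instModule : Module K (LeavittPathAlgebra K E) :=
  Function.Surjective.module K (mk K E : FreeLeavittAlgebra K E →+ LeavittPathAlgebra K E)
    (mk_surjective K E) (mk_smul K E)

instance instIsScalarTower : IsScalarTower K (LeavittPathAlgebra K E) (LeavittPathAlgebra K E) where
  smul_assoc c x y := by
    obtain ⟨x, rfl⟩ := mk_surjective K E x
    obtain ⟨y, rfl⟩ := mk_surjective K E y
    simp only [smul_eq_mul, ← mk_smul, ← map_mul, smul_mul_assoc]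

instance instSMulCommClass : SMulCommClass K (LeavittPathAlgebra K E) (LeavittPathAlgebra K E) where
  smul_comm c x y := by
    obtain ⟨x, rfl⟩ := mk_surjective K E x
    obtain ⟨y, rfl⟩ := mk_surjective K E y
    simp only [smul_eq_mul, ← mk_smul, ← map_mul, mul_smul_comm]

end LeavittPathAlgebra

/-- The Leavitt algebra `L_K(1,n)`, for `n` a natural number or `∞`: the Leavitt path algebra of the
rose with `n` petals. -/
abbrev LeavittAlgebra (K : Type*) [Field K] (n : ℕ∞) : Type _ :=
  LeavittPathAlgebra K (roseGraph n)

/-! ### Finitely supported matrices -/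

/-- The additive group of square matrices, with rows and columns indexed by `ι`, that have only
finitely many nonzero entries. -/
def FinSuppMatrix (ι : Type*) (R : Type*) [NonUnitalRing R] : AddSubgroup (Matrix ι ι R) where
  carrier := {A | {p : ι × ι | A p.1 p.2 ≠ 0}.Finite}
  zero_mem' := by simp
  add_mem' {A B} hA hB := by
    refine (hA.union hB).subset fun p hp => ?_
    by_contra h
    simp only [Set.mem_union, Set.mem_ofPred_eq, not_or, not_not] at h
    exact hp (by simp [h.1, h.2])
  neg_mem' {A} hA := by
    refine hA.subset fun p hp => ?_
    simpa using hp

namespace FinSuppMatrix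

variable {ι R : Type*} [NonUnitalRing R]

/-- The product of matrices has entries `∑ k, A i k * B k j`: a sum with only finitely many nonzero
terms. -/
noncomputable def mulEntry (A B : Matrix ι ι R) : Matrix ι ι R :=
  fun i j => ∑ᶠ k, A i k * B k j

/-- The nonzero entries lie in a square block indexed by a finite set. -/
theorem exists_finset (A : FinSuppMatrix ι R) :
    ∃ s : Finset ι, ∀ i j, A.1 i j ≠ 0 → i ∈ s ∧ j ∈ s := by
  classical
  refine ⟨A.2.toFinset.image Prod.fst ∪ A.2.toFinset.image Prod.snd, fun i j h => ?_⟩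
  have h' : (i, j) ∈ A.2.toFinset := (Set.Finite.mem_toFinset _).2 h
  exact ⟨Finset.mem_union_left _ (Finset.mem_image.2 ⟨_, h', rfl⟩),
    Finset.mem_union_right _ (Finset.mem_image.2 ⟨_, h', rfl⟩)⟩

theorem mulEntry_eq_sum_left (A B : Matrix ι ι R) (s : Finset ι)
    (hs : ∀ i j, A i j ≠ 0 → i ∈ s ∧ j ∈ s) (i j : ι) :
    mulEntry A B i j = ∑ k ∈ s, A i k * B k j := by
  refine finsum_eq_sum_of_support_subset _ fun k hk => ?_
  by_contra h
  have h0 : A i k = 0 := by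
    by_contra h0
    exact h (hs i k h0).2
  exact hk (by simp [h0])

theorem mulEntry_eq_sum_right (A B : Matrix ι ι R) (s : Finset ι)
    (hs : ∀ i j, B i j ≠ 0 → i ∈ s ∧ j ∈ s) (i j : ι) :
    mulEntry A B i j = ∑ k ∈ s, A i k * B k j := by
  refine finsum_eq_sum_of_support_subset _ fun k hk => ?_
  by_contra h
  have h0 : B k j = 0 := by
    by_contra h0
    exact h (hs k j h0).1
  exact hk (by simp [h0])

theorem mulEntry_mem (A B : FinSuppMatrix ι R) : mulEntry A.1 B.1 ∈ FinSuppMatrix ι R := by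
  obtain ⟨s, hs⟩ := exists_finset A
  obtain ⟨t, ht⟩ := exists_finset B
  refine (s ×ˢ t).finite_toSet.subset fun p hp => ?_
  have hp' : mulEntry A.1 B.1 p.1 p.2 ≠ 0 := hp
  rw [mulEntry_eq_sum_left _ _ s hs] at hp'
  obtain ⟨k, -, hk⟩ := Finset.exists_ne_zero_of_sum_ne_zero hp'
  have h1 : A.1 p.1 k ≠ 0 := left_ne_zero_of_mul hk
  have h2 : B.1 k p.2 ≠ 0 := right_ne_zero_of_mul hk
  simpa using ⟨(hs _ _ h1).1, (ht _ _ h2).2⟩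

noncomputable instance instMul : Mul (FinSuppMatrix ι R) where
  mul A B := ⟨mulEntry A.1 B.1, mulEntry_mem A B⟩

theorem coe_mul (A B : FinSuppMatrix ι R) : (A * B).1 = mulEntry A.1 B.1 := rfl

noncomputable instance instNonUnitalRing : NonUnitalRing (FinSuppMatrix ι R) where
  left_distrib A B C := by
    obtain ⟨s, hs⟩ := exists_finset A
    ext i j
    change mulEntry A.1 (B.1 + C.1) i j = mulEntry A.1 B.1 i j + mulEntry A.1 C.1 i j
    simp only [mulEntry_eq_sum_left _ _ s hs, Matrix.add_apply, mul_add, Finset.sum_add_distrib]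
  right_distrib A B C := by
    obtain ⟨s, hs⟩ := exists_finset C
    ext i j
    change mulEntry (A.1 + B.1) C.1 i j = mulEntry A.1 C.1 i j + mulEntry B.1 C.1 i j
    simp only [mulEntry_eq_sum_right _ _ s hs, Matrix.add_apply, add_mul, Finset.sum_add_distrib]
  zero_mul A := by
    ext i j
    change mulEntry 0 A.1 i j = 0
    simp [mulEntry]
  mul_zero A := by
    ext i j
    change mulEntry A.1 0 i j = 0
    simp [mulEntry]
  mul_assoc A B C := by
    obtain ⟨s, hs⟩ := exists_finset A
    obtain ⟨t, ht⟩ := exists_finset C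
    ext i j
    change mulEntry (mulEntry A.1 B.1) C.1 i j = mulEntry A.1 (mulEntry B.1 C.1) i j
    simp only [mulEntry_eq_sum_left A.1 _ s hs, mulEntry_eq_sum_right _ C.1 t ht,
      Finset.sum_mul, Finset.mul_sum, mul_assoc]
    exact Finset.sum_comm

end FinSuppMatrix

/-- The matrix ring `M_m(R)`: all `m × m` matrices if `m` is finite, and the countably infinite
matrices with only finitely many nonzero entries if `m = ∞`. -/
abbrev MatrixRing (m : ℕ∞) (R : Type*) [NonUnitalRing R] : Type _ :=
  FinSuppMatrix (InitialSegment m) R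

/-! ### The socle -/

section Socle

variable {R : Type*} [NonUnitalRing R]

/-- An additive subgroup closed under multiplication by ring elements from the left. -/
def IsLeftIdeal (I : AddSubgroup R) : Prop := ∀ a x : R, x ∈ I → a * x ∈ I

/-- An additive subgroup closed under multiplication by ring elements from the right. -/
def IsRightIdeal (I : AddSubgroup R) : Prop := ∀ a x : R, x ∈ I → x * a ∈ I

/-- A minimal left ideal: minimal among the nonzero left ideals. -/
def IsMinimalLeftIdeal (I : AddSubgroup R) : Prop :=
  Minimal (fun J : AddSubgroup R => IsLeftIdeal J ∧ J ≠ ⊥) I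

/-- A minimal right ideal: minimal among the nonzero right ideals. -/
def IsMinimalRightIdeal (I : AddSubgroup R) : Prop :=
  Minimal (fun J : AddSubgroup R => IsRightIdeal J ∧ J ≠ ⊥) I

variable (R)

/-- The left socle: the sum of all minimal left ideals. -/
def leftSocle : AddSubgroup R := sSup {I | IsMinimalLeftIdeal I}

/-- The right socle: the sum of all minimal right ideals. In a semiprime ring it coincides with the
left socle. -/
def rightSocle : AddSubgroup R := sSup {I | IsMinimalRightIdeal I}

end Socle

/-! ### Families of isometries generating an algebra -/

/-! It suffices that the Leavitt algebra `A` has no minimal one-sided ideals. The entries at a fixed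
position of the members of a minimal one-sided ideal of matrices form a minimal ideal of `A` on the
same side (`exists_isMinimalLeftIdeal`, `exists_isMinimalRightIdeal`).

With one petal, `A` is the Laurent polynomial ring (`laurentEquiv`), a domain with the nonzero
nonunit `T 1 + 1`. In a domain, minimality of an ideal containing `z ≠ 0` gives `z = r * t * z` for
every `t ≠ 0`; cancelling `z` makes every nonzero `t` invertible.

With at least two petals, every nonzero `x` satisfies `a * x * b = 1` for some `a`, `b`
(`exists_mul_mul_eq_one`). A suitable right multiple of `x` is a nonzero combination of real paths.
The ghost of a shortest path occurring in it moves that combination to `c • 1 + q`, with `c ≠ 0` and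
`q` made of paths of positive length. Conjugation by `i ^ N j` for large `N` removes `q`. Minimality
would then give one-sided inverses to all nonzero elements, against `s i * e j = 0` for `i ≠ j`.

No normal form or linear independence of paths is needed in this second case: only the relations of
`IsRoseFamily` are used, and the zero ring is treated apart. -/

/-- A family of edges and ghost edges in a unital algebra that satisfies the relations of a rose
and generates the algebra. -/
structure IsRoseFamily (K : Type*) [Field K] {ι A : Type*} [Ring A] [Algebra K A]
    (e s : ι → A) : Prop where
  ghost_mul_edge_self : ∀ i, s i * e i = 1
  ghost_mul_edge_of_ne : ∀ i j, i ≠ j → s i * e j = 0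
  -- The relation is vacuous for infinite `ι`, which lets one structure cover finite and infinite
  -- roses.
  sum_eq_one : ∀ [Fintype ι], ∑ i, e i * s i = 1
  adjoin_eq_top : Algebra.adjoin K (Set.range e ∪ Set.range s) = ⊤

/-- The product of a family along a path. -/
def pathProd {ι A : Type*} [Monoid A] (e : ι → A) (w : List ι) : A := (w.map e).prod

theorem pathProd_append {ι A : Type*} [Monoid A] (e : ι → A) (v w : List ι) :
    pathProd e (v ++ w) = pathProd e v * pathProd e w := by
  simp [pathProd]

theorem pathProd_cons {ι A : Type*} [Monoid A] (e : ι → A) (i : ι) (w : List ι) :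
    pathProd e (i :: w) = e i * pathProd e w := by
  simp [pathProd]

theorem pathProd_nil {ι A : Type*} [Monoid A] (e : ι → A) : pathProd e [] = 1 := rfl

theorem pathProd_singleton {ι A : Type*} [Monoid A] (e : ι → A) (i : ι) :
    pathProd e [i] = e i := by
  simp [pathProd]

/-- The span of the real paths. -/
def pathSpan (K : Type*) [Field K] {ι A : Type*} [Ring A] [Algebra K A] (e : ι → A) :
    Submodule K A := Submodule.span K (Set.range (pathProd e))

/-- The span of the real paths of positive length. -/
def positivePathSpan (K : Type*) [Field K] {ι A : Type*} [Ring A] [Algebra K A] (e : ι → A) :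
    Submodule K A := Submodule.span K (pathProd e '' {w | w ≠ []})

theorem pathProd_mem_pathSpan (K : Type*) [Field K] {ι A : Type*} [Ring A] [Algebra K A]
    (e : ι → A) (w : List ι) : pathProd e w ∈ pathSpan K e :=
  Submodule.subset_span ⟨w, rfl⟩

theorem pathProd_mul_mem_pathSpan {K : Type*} [Field K] {ι A : Type*} [Ring A] [Algebra K A]
    {e : ι → A} {p : A} (w : List ι) (hp : p ∈ pathSpan K e) :
    pathProd e w * p ∈ pathSpan K e := by
  induction hp using Submodule.span_induction with
  | mem x hx =>
    obtain ⟨v, rfl⟩ := hx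
    rw [← pathProd_append]
    exact pathProd_mem_pathSpan K e _
  | zero => simp
  | add x y _ _ hx hy => rw [mul_add]; exact add_mem hx hy
  | smul c x _ hx => rw [mul_smul_comm]; exact Submodule.smul_mem _ c hx

namespace IsRoseFamily

variable {K : Type*} [Field K] {ι A : Type*} [Ring A] [Algebra K A] {e s : ι → A}

/-- A subspace that contains `1` and is stable under left multiplication by the generators is
everything. -/
theorem mem_of_stable (h : IsRoseFamily K e s) (M : Submodule K A) (h1 : 1 ∈ M)
    (he : ∀ i, ∀ x ∈ M, e i * x ∈ M) (hs : ∀ i, ∀ x ∈ M, s i * x ∈ M) (x : A) : x ∈ M := by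
  have hx : x ∈ Algebra.adjoin K (Set.range e ∪ Set.range s) := h.adjoin_eq_top ▸ Algebra.mem_top
  -- Stability of `M` under left multiplication by `x` passes to products, unlike membership of `x`
  -- in `M`.
  suffices ∀ y ∈ M, x * y ∈ M by simpa using this 1 h1
  induction hx using Algebra.adjoin_induction with
  | mem x hx =>
    rcases hx with ⟨i, rfl⟩ | ⟨i, rfl⟩
    exacts [he i, hs i]
  | algebraMap c =>
    intro y hy
    rw [← Algebra.smul_def]
    exact M.smul_mem c hy
  | add x y _ _ hx hy =>
    intro z hz
    rw [add_mul]
    exact add_mem (hx z hz) (hy z hz)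
  | mul x y _ _ hx hy =>
    intro z hz
    rw [mul_assoc]
    exact hx _ (hy z hz)

/-! ### Products of ghost paths with real paths. -/

theorem ghostPath_mul_append (h : IsRoseFamily K e s) (w v : List ι) :
    pathProd s w.reverse * pathProd e (w ++ v) = pathProd e v := by
  induction w with
  | nil => simp [pathProd_nil]
  | cons i w ih =>
    rw [List.reverse_cons, pathProd_append, List.cons_append, pathProd_singleton s, pathProd_cons,
      mul_assoc, ← mul_assoc (s i), h.ghost_mul_edge_self, one_mul, ih]

/-- Edges cancel up to the first letter where the two words differ, and there the product is `s i *
e j = 0`. The length bound excludes the case that `v` is a proper prefix of `w`, where a ghost path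
would be left over. -/
theorem ghostPath_mul_eq_zero (h : IsRoseFamily K e s) (w : List ι) :
    ∀ v : List ι, w.length ≤ v.length → ¬ w <+: v →
      pathProd s w.reverse * pathProd e v = 0 := by
  induction w with
  | nil => intro v _ hv; exact absurd List.nil_prefix hv
  | cons i w ih =>
    intro v hl hv
    cases v with
    | nil => simp at hl
    | cons j v =>
      rw [List.reverse_cons, pathProd_append, pathProd_singleton s, pathProd_cons,
        mul_assoc, ← mul_assoc (s i)]
      by_cases hij : i = j
      · subst hij
        rw [h.ghost_mul_edge_self, one_mul]
        refine ih v (by simpa using hl) fun hw => hv ?_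
        simpa [List.cons_prefix_cons] using hw
      · rw [h.ghost_mul_edge_of_ne i j hij, zero_mul, mul_zero]

/-- A nonzero combination of real paths can be moved by a ghost path to one with nonzero
constant term. -/
theorem exists_mul_eq_add_positive (h : IsRoseFamily K e s) {p : A} (hp : p ∈ pathSpan K e)
    (hp0 : p ≠ 0) :
    ∃ (a : A) (c : K) (q : A), c ≠ 0 ∧ q ∈ positivePathSpan K e ∧ a * p = c • 1 + q := by
  classical
  obtain ⟨f, rfl⟩ := Finsupp.mem_span_range_iff_exists_finsupp.1 hp
  have hf : f.support.Nonempty := by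
    rw [Finsupp.support_nonempty_iff]
    rintro rfl
    simp at hp0
  -- Since `w` is shortest, every other path in the support either extends `w` properly, and becomes
  -- a path of positive length, or is killed by the ghost of `w`.
  obtain ⟨w, hw, hmin⟩ := f.support.exists_min_image List.length hf
  refine ⟨pathProd s w.reverse, f w,
    ∑ v ∈ f.support.erase w, f v • (pathProd s w.reverse * pathProd e v),
    Finsupp.mem_support_iff.1 hw, Submodule.sum_mem _ fun v hv => Submodule.smul_mem _ _ ?_, ?_⟩
  · obtain ⟨hvw, hv⟩ := Finset.mem_erase.1 hv
    by_cases hpre : w <+: v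
    · obtain ⟨u, rfl⟩ := hpre
      rw [h.ghostPath_mul_append]
      refine Submodule.subset_span ⟨u, ?_, rfl⟩
      rintro rfl
      simp at hvw
    · rw [h.ghostPath_mul_eq_zero w v (hmin v hv) hpre]
      exact zero_mem _
  · have hself := h.ghostPath_mul_append w []
    rw [List.append_nil, pathProd_nil] at hself
    rw [Finsupp.sum, ← Finset.add_sum_erase _ _ hw, mul_add, mul_smul_comm, hself,
      Finset.mul_sum]
    simp only [mul_smul_comm]

/-- A path of positive length survives only the ghost of its first edge, so a finite combination
survives only finitely many ghost edges. -/
theorem eventually_ghost_mul_eq_zero (h : IsRoseFamily K e s) {q : A}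
    (hq : q ∈ positivePathSpan K e) : ∀ᶠ j in Filter.cofinite, s j * q = 0 := by
  induction hq using Submodule.span_induction with
  | mem x hx =>
    obtain ⟨w, hw, rfl⟩ := hx
    obtain ⟨i, v, rfl⟩ := List.exists_cons_of_ne_nil hw
    filter_upwards [(Set.finite_singleton i).compl_mem_cofinite] with j hj
    rw [pathProd_cons, ← mul_assoc, h.ghost_mul_edge_of_ne j i hj, zero_mul]
  | zero => simp
  | add x y _ _ hx hy =>
    filter_upwards [hx, hy] with j hx hy
    rw [mul_add, hx, hy, add_zero]
  | smul c x _ hx =>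
    filter_upwards [hx] with j hx
    rw [mul_smul_comm, hx, smul_zero]

/-- Conjugation by the path `i ^ N j` kills a combination of paths of positive length as soon as
`N` is large. -/
theorem eventually_conj_eq_zero (h : IsRoseFamily K e s) {i j : ι} (hij : i ≠ j) {q : A}
    (hq : q ∈ positivePathSpan K e) :
    ∀ᶠ N in Filter.atTop, pathProd s (List.replicate N i ++ [j]).reverse * q *
      pathProd e (List.replicate N i ++ [j]) = 0 := by
  induction hq using Submodule.span_induction with
  | mem x hx =>
    obtain ⟨w, hw, rfl⟩ := hx
    filter_upwards [Filter.eventually_ge_atTop w.length] with N hN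
    rw [mul_assoc, ← pathProd_append]
    -- If `i ^ N j` were a prefix of `w` followed by `i ^ N j`, compare the letters at index `N`:
    -- the first word has `j`, while the second has `i`, because `1 ≤ w.length ≤ N` shifts the index
    -- into the block of `i`s.
    refine h.ghostPath_mul_eq_zero _ _ (by simp) fun hpre => hij ?_
    have hlt : N < (List.replicate N i ++ [j]).length := by simp
    have hget := hpre.getElem hlt
    have hpos := List.length_pos_iff.2 hw
    rw [List.getElem_append_right (by simp), List.getElem_append_right hN,
      List.getElem_append_left (by simp; omega)] at hget
    simpa using hget.symm
  | zero => simp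
  | add x y _ _ hx hy =>
    filter_upwards [hx, hy] with j hx hy
    rw [mul_add, add_mul, hx, hy, add_zero]
  | smul c x _ hx =>
    filter_upwards [hx] with j hx
    rw [mul_smul_comm, smul_mul_assoc, hx, smul_zero]

/-! ### Faithfulness of right multiplication by the edges. -/

theorem eq_zero_of_eventually_mul_edge [Infinite ι] (h : IsRoseFamily K e s) {p : A}
    (hp : p ∈ pathSpan K e) (hpe : ∀ᶠ j in Filter.cofinite, p * e j = 0) : p = 0 := by
  by_contra hp0
  obtain ⟨a, c, q, hc, hq, ha⟩ := h.exists_mul_eq_add_positive hp hp0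
  -- The cofinite filter is proper as `ι` is infinite, so some `j` has both `p * e j = 0` and `s j *
  -- q = 0`. Sandwiching `a * p = c • 1 + q` between `s j` and `e j` leaves `c • 1 = 0`. Hence `1 =
  -- 0`, which already forces `p = 0`.
  obtain ⟨j, hj, hjq⟩ := (hpe.and (h.eventually_ghost_mul_eq_zero hq)).exists
  have h0 : s j * (a * p) * e j = 0 := by
    rw [mul_assoc, mul_assoc, hj, mul_zero, mul_zero]
  rw [ha, mul_add, hjq, add_zero, mul_smul_comm, mul_one, smul_mul_assoc,
    h.ghost_mul_edge_self] at h0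
  apply hp0
  rw [← mul_one p, (smul_eq_zero.1 h0).resolve_left hc, mul_zero]

/-- Every element is a combination of real paths up to the left ideal generated by the ghost
edges. -/
theorem mem_pathSpan_sup (h : IsRoseFamily K e s) (x : A) :
    x ∈ pathSpan K e ⊔ (Ideal.span (Set.range s)).restrictScalars K := by
  refine h.mem_of_stable _ (Submodule.mem_sup_left (pathProd_mem_pathSpan K e [])) ?_ ?_ x
  · intro i x hx
    obtain ⟨p, hp, y, hy, rfl⟩ := Submodule.mem_sup.1 hx
    rw [mul_add]
    refine Submodule.add_mem_sup ?_ (Ideal.mul_mem_left _ (e i) hy)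
    simpa [pathProd_singleton] using pathProd_mul_mem_pathSpan [i] hp
  · intro i x hx
    obtain ⟨p, hp, y, hy, rfl⟩ := Submodule.mem_sup.1 hx
    rw [mul_add]
    refine add_mem ?_ (Submodule.mem_sup_right (Ideal.mul_mem_left _ (s i) hy))
    clear hx
    induction hp using Submodule.span_induction with
    | mem x hx =>
      obtain ⟨w, rfl⟩ := hx
      cases w with
      | nil =>
        rw [pathProd_nil, mul_one]
        exact Submodule.mem_sup_right (Ideal.subset_span ⟨i, rfl⟩)
      | cons j w =>
        rw [pathProd_cons, ← mul_assoc]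
        by_cases hij : i = j
        · subst hij
          rw [h.ghost_mul_edge_self, one_mul]
          exact Submodule.mem_sup_left (pathProd_mem_pathSpan K e w)
        · rw [h.ghost_mul_edge_of_ne i j hij, zero_mul]
          exact zero_mem _
    | zero => simp
    | add x y _ _ hx hy => rw [mul_add]; exact add_mem hx hy
    | smul c x _ hx => rw [mul_smul_comm]; exact Submodule.smul_mem _ c hx

theorem eq_zero_of_forall_mul_edge (h : IsRoseFamily K e s) {x : A} (hx : ∀ j, x * e j = 0) :
    x = 0 := by
  classical
  cases finite_or_infinite ι with
  | inl _ =>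
    have := Fintype.ofFinite ι
    rw [← mul_one x, ← h.sum_eq_one, Finset.mul_sum]
    exact Finset.sum_eq_zero fun i _ => by rw [← mul_assoc, hx, zero_mul]
  | inr _ =>
    obtain ⟨p, hp, y, hy, rfl⟩ := Submodule.mem_sup.1 (h.mem_pathSpan_sup x)
    obtain ⟨f, rfl⟩ := Finsupp.mem_ideal_span_range_iff_exists_finsupp.1 hy
    -- Right multiplication by `e j` reads off the coefficient of `s j`; outside the finite support
    -- of `f` it therefore sees only the real part `p`.
    have hf (j : ι) : (f.sum fun i a => a * s i) * e j = f j := by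
      rw [Finsupp.sum_mul, Finsupp.sum, Finset.sum_eq_single j]
      · rw [mul_assoc, h.ghost_mul_edge_self, mul_one]
      · intro i _ hij
        rw [mul_assoc, h.ghost_mul_edge_of_ne i j hij, mul_zero]
      · intro hj
        rw [Finsupp.notMem_support_iff.1 hj, zero_mul, zero_mul]
    have hp0 : p = 0 := by
      refine h.eq_zero_of_eventually_mul_edge hp ?_
      filter_upwards [f.support.finite_toSet.compl_mem_cofinite] with j hj
      have := hx j
      rwa [add_mul, hf, Finsupp.notMem_support_iff.1 hj, add_zero] at this
    subst hp0
    have : f = 0 := by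
      ext j
      have := hx j
      rwa [zero_add, hf] at this
    simp [this]

/-- Right multiplication by long real paths makes every element a combination of real paths. -/
theorem exists_length_mul_mem (h : IsRoseFamily K e s) (x : A) :
    ∃ N : ℕ, ∀ w : List ι, N ≤ w.length → x * pathProd e w ∈ pathSpan K e := by
  let M : Submodule K A :=
    { carrier := {x | ∃ N : ℕ, ∀ w : List ι, N ≤ w.length → x * pathProd e w ∈ pathSpan K e}
      zero_mem' := ⟨0, fun w _ => by simp⟩
      add_mem' := by
        rintro x y ⟨M, hM⟩ ⟨N, hN⟩
        refine ⟨max M N, fun w hw => ?_⟩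
        rw [add_mul]
        exact add_mem (hM w (le_of_max_le_left hw)) (hN w (le_of_max_le_right hw))
      smul_mem' := by
        rintro c x ⟨M, hM⟩
        refine ⟨M, fun w hw => ?_⟩
        rw [smul_mul_assoc]
        exact Submodule.smul_mem _ c (hM w hw) }
  refine h.mem_of_stable M ⟨0, fun w _ => ?_⟩ ?_ ?_ x
  · rw [one_mul]
    exact pathProd_mem_pathSpan K e w
  · rintro i x ⟨N, hN⟩
    refine ⟨N, fun w hw => ?_⟩
    rw [mul_assoc, ← pathProd_singleton e i]
    exact pathProd_mul_mem_pathSpan [i] (hN w hw)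
  · rintro i x ⟨N, hN⟩
    -- The first `N` letters turn `x` into real paths. The extra letter keeps the remainder
    -- nonempty, so that `s i` always meets an edge, even for the constant term.
    refine ⟨N + 1, fun w hw => ?_⟩
    have hlen : (w.take N).length = N := by simp; omega
    have hx := hN (w.take N) hlen.ge
    rw [← List.take_append_drop N w, pathProd_append, mul_assoc, ← mul_assoc x]
    generalize x * pathProd e (w.take N) = p at hx
    have hne : w.drop N ≠ [] := by simp; omega
    generalize w.drop N = v at hne
    induction hx using Submodule.span_induction with
    | mem x hx =>
      obtain ⟨u, rfl⟩ := hx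
      rw [← pathProd_append]
      obtain ⟨j, t, ht⟩ := List.exists_cons_of_ne_nil (List.append_ne_nil_of_right_ne_nil u hne)
      rw [ht, pathProd_cons, ← mul_assoc]
      by_cases hij : i = j
      · subst hij
        rw [h.ghost_mul_edge_self, one_mul]
        exact pathProd_mem_pathSpan K e t
      · rw [h.ghost_mul_edge_of_ne i j hij, zero_mul]
        exact zero_mem _
    | zero => simp
    | add x y _ _ hx hy => rw [add_mul, mul_add]; exact add_mem hx hy
    | smul c x _ hx => rw [smul_mul_assoc, mul_smul_comm]; exact Submodule.smul_mem _ c hx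

/-- Some edge does not annihilate `x` on the right, and multiplying by it lowers by one the length
needed to reach real paths. -/
theorem exists_mul_mem_pathSpan (h : IsRoseFamily K e s) {x : A} (hx : x ≠ 0) :
    ∃ b : A, x * b ∈ pathSpan K e ∧ x * b ≠ 0 := by
  obtain ⟨N, hN⟩ := h.exists_length_mul_mem x
  induction N generalizing x with
  | zero => exact ⟨1, by simpa [pathProd_nil] using hN [] (by simp), by simpa using hx⟩
  | succ N ih =>
    obtain ⟨j, hj⟩ : ∃ j, x * e j ≠ 0 := by
      by_contra! hall
      exact hx (h.eq_zero_of_forall_mul_edge hall)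
    obtain ⟨b, hb, hb0⟩ := ih hj fun w hw => by
      rw [mul_assoc, ← pathProd_cons]
      exact hN _ (by simpa using hw)
    exact ⟨e j * b, by rwa [← mul_assoc], by rwa [← mul_assoc]⟩

/-- With at least two petals, every nonzero element can be carried to `1`. -/
theorem exists_mul_mul_eq_one [Nontrivial ι] (h : IsRoseFamily K e s) {x : A} (hx : x ≠ 0) :
    ∃ a b : A, a * x * b = 1 := by
  obtain ⟨b, hb, hb0⟩ := h.exists_mul_mem_pathSpan hx
  obtain ⟨a, c, q, hc, hq, ha⟩ := h.exists_mul_eq_add_positive hb hb0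
  obtain ⟨i, j, hij⟩ := exists_pair_ne ι
  -- Conjugation by `i ^ N j` preserves `c • 1` and kills `q`.
  obtain ⟨N, hN⟩ := (h.eventually_conj_eq_zero hij hq).exists
  set w := List.replicate N i ++ [j]
  have hself := h.ghostPath_mul_append w []
  rw [List.append_nil, pathProd_nil] at hself
  refine ⟨c⁻¹ • (pathProd s w.reverse * a), b * pathProd e w, ?_⟩
  calc c⁻¹ • (pathProd s w.reverse * a) * x * (b * pathProd e w)
      = c⁻¹ • (pathProd s w.reverse * (a * (x * b)) * pathProd e w) := by
        simp only [smul_mul_assoc, mul_assoc]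
    _ = 1 := by
        rw [ha, mul_add, add_mul, hN, add_zero, mul_smul_comm, mul_one, smul_mul_assoc, hself,
          inv_smul_smul₀ hc]

end IsRoseFamily

/-! ### Minimal one-sided ideals -/

section MinimalIdeals

variable {R : Type*} [NonUnitalRing R]

theorem leftSocle_eq_bot (h : ∀ I : AddSubgroup R, ¬ IsMinimalLeftIdeal I) :
    leftSocle R = ⊥ :=
  sSup_eq_bot.2 fun I hI => absurd hI (h I)

theorem rightSocle_eq_bot (h : ∀ I : AddSubgroup R, ¬ IsMinimalRightIdeal I) :
    rightSocle R = ⊥ :=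
  sSup_eq_bot.2 fun I hI => absurd hI (h I)

theorem IsMinimalLeftIdeal.exists_ne_zero {I : AddSubgroup R} (hI : IsMinimalLeftIdeal I) :
    ∃ x ∈ I, x ≠ 0 := AddSubgroup.ne_bot_iff_exists_ne_zero.1 hI.1.2 |>.elim
  fun x hx => ⟨x, x.2, by simpa using hx⟩

theorem IsMinimalRightIdeal.exists_ne_zero {I : AddSubgroup R} (hI : IsMinimalRightIdeal I) :
    ∃ x ∈ I, x ≠ 0 := AddSubgroup.ne_bot_iff_exists_ne_zero.1 hI.1.2 |>.elim
  fun x hx => ⟨x, x.2, by simpa using hx⟩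

/-- A nonzero left ideal inside a minimal one contains it. -/
theorem IsMinimalLeftIdeal.le_of_mem {I J : AddSubgroup R} (hI : IsMinimalLeftIdeal I)
    (hJ : IsLeftIdeal J) (hJI : J ≤ I) {x : R} (hx : x ∈ J) (hx0 : x ≠ 0) : I ≤ J :=
  hI.2 ⟨hJ, fun h => hx0 (by simpa [h] using hx)⟩ hJI

/-- A nonzero right ideal inside a minimal one contains it. -/
theorem IsMinimalRightIdeal.le_of_mem {I J : AddSubgroup R} (hI : IsMinimalRightIdeal I)
    (hJ : IsRightIdeal J) (hJI : J ≤ I) {x : R} (hx : x ∈ J) (hx0 : x ≠ 0) : I ≤ J :=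
  hI.2 ⟨hJ, fun h => hx0 (by simpa [h] using hx)⟩ hJI

end MinimalIdeals

/-! ### Minimal one-sided ideals of unital rings. -/

section Unital

variable {A : Type*} [Ring A]

/-- The principal left ideal generated by `t * z` is nonzero and lies in `I`, so by minimality it
contains `z`. -/
theorem IsMinimalLeftIdeal.exists_eq_mul_mul {I : AddSubgroup A} (hI : IsMinimalLeftIdeal I)
    {t z : A} (hz : z ∈ I) (htz : t * z ≠ 0) : ∃ r, z = r * t * z := by
  have hle := hI.le_of_mem (J := (AddMonoidHom.mulRight (t * z)).range) (x := t * z) ?_ ?_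
    ⟨1, one_mul _⟩ htz hz
  · obtain ⟨r, hr⟩ := hle
    exact ⟨r, by rw [mul_assoc]; exact hr.symm⟩
  · rintro a _ ⟨r, rfl⟩
    exact ⟨a * r, mul_assoc _ _ _⟩
  · rintro _ ⟨r, rfl⟩
    exact hI.1.1 _ _ (hI.1.1 _ _ hz)

theorem IsMinimalRightIdeal.exists_eq_mul_mul {I : AddSubgroup A} (hI : IsMinimalRightIdeal I)
    {t z : A} (hz : z ∈ I) (hzt : z * t ≠ 0) : ∃ r, z = z * (t * r) := by
  have hle := hI.le_of_mem (J := (AddMonoidHom.mulLeft (z * t)).range) (x := z * t) ?_ ?_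
    ⟨1, mul_one _⟩ hzt hz
  · obtain ⟨r, hr⟩ := hle
    exact ⟨r, by rw [← mul_assoc]; exact hr.symm⟩
  · rintro a _ ⟨r, rfl⟩
    exact ⟨r * a, (mul_assoc _ _ _).symm⟩
  · rintro _ ⟨r, rfl⟩
    exact hI.1.1 _ _ (hI.1.1 _ _ hz)

/-- If every nonzero element can be carried to `1`, then zero divisors exclude minimal left
ideals. -/
theorem not_isMinimalLeftIdeal_of_carry (hA : ∀ x : A, x ≠ 0 → ∃ a b, a * x * b = 1)
    {t u : A} (ht : t ≠ 0) (hu : u ≠ 0) (htu : t * u = 0) (I : AddSubgroup A) :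
    ¬ IsMinimalLeftIdeal I := by
  intro hI
  obtain ⟨x, hx, hx0⟩ := hI.exists_ne_zero
  obtain ⟨a, b, hab⟩ := hA x hx0
  have htz : t * (a * x) ≠ 0 := fun h0 => ht (by rw [← mul_one t, ← hab, ← mul_assoc, h0, zero_mul])
  obtain ⟨r, hr⟩ := hI.exists_eq_mul_mul (hI.1.1 a x hx) htz
  -- The element `z = a * x` has the right inverse `b`, so `z = r * t * z` becomes `1 = r * t`.
  have hrt : r * t = 1 := by
    rw [← mul_one (r * t), ← hab, ← mul_assoc (r * t), ← hr]
  exact hu (by rw [← one_mul u, ← hrt, mul_assoc, htu, mul_zero])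

/-- If every nonzero element can be carried to `1`, then zero divisors exclude minimal right
ideals. -/
theorem not_isMinimalRightIdeal_of_carry (hA : ∀ x : A, x ≠ 0 → ∃ a b, a * x * b = 1)
    {t u : A} (ht : t ≠ 0) (hu : u ≠ 0) (htu : t * u = 0) (I : AddSubgroup A) :
    ¬ IsMinimalRightIdeal I := by
  intro hI
  obtain ⟨x, hx, hx0⟩ := hI.exists_ne_zero
  obtain ⟨a, b, hab⟩ := hA x hx0
  have hzu : x * b * u ≠ 0 := fun h0 => hu (by
    rw [← one_mul u, ← hab, mul_assoc a, mul_assoc a, h0, mul_zero])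
  obtain ⟨r, hr⟩ := hI.exists_eq_mul_mul (hI.1.1 b x hx) hzu
  have hur : u * r = 1 := by
    rw [← one_mul (u * r), ← hab, mul_assoc a, mul_assoc a, ← hr]
  exact ht (by rw [← mul_one t, ← hur, ← mul_assoc, htu, zero_mul])

/-- A domain with a nonzero element that is not left invertible has no minimal left ideals. -/
theorem not_isMinimalLeftIdeal_of_domain [IsDomain A] {t : A} (ht : t ≠ 0)
    (hu : ∀ r, r * t ≠ 1) (I : AddSubgroup A) : ¬ IsMinimalLeftIdeal I := by
  intro hI
  obtain ⟨z, hz, hz0⟩ := hI.exists_ne_zero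
  obtain ⟨r, hr⟩ := hI.exists_eq_mul_mul hz (mul_ne_zero ht hz0)
  exact hu r (mul_right_cancel₀ hz0 (by rw [← hr, one_mul]))

/-- A domain with a nonzero element that is not right invertible has no minimal right ideals. -/
theorem not_isMinimalRightIdeal_of_domain [IsDomain A] {t : A} (ht : t ≠ 0)
    (hu : ∀ r, t * r ≠ 1) (I : AddSubgroup A) : ¬ IsMinimalRightIdeal I := by
  intro hI
  obtain ⟨z, hz, hz0⟩ := hI.exists_ne_zero
  obtain ⟨r, hr⟩ := hI.exists_eq_mul_mul hz (mul_ne_zero hz0 ht)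
  exact hu r (mul_left_cancel₀ hz0 (by rw [← hr, mul_one]))

end Unital

/-! ### Passing to matrices -/

namespace FinSuppMatrix

variable {ι A : Type*} [Ring A]

open Classical in
/-- The matrix with the entry `a` at `(i, i)` and zeros elsewhere. -/
noncomputable def diagUnit (i : ι) (a : A) : FinSuppMatrix ι A :=
  ⟨Matrix.single i i a, (Set.finite_singleton (i, i)).subset fun p hp => by
    by_contra h
    refine hp (Matrix.single_apply_of_ne _ _ _ _ _ ?_)
    rintro ⟨h1, h2⟩
    exact h (Prod.ext h1.symm h2.symm)⟩

open Classical in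
theorem diagUnit_mul_apply (i : ι) (a : A) (B : FinSuppMatrix ι A) (k j : ι) :
    (diagUnit i a * B).1 k j = if k = i then a * B.1 i j else 0 := by
  rw [coe_mul, mulEntry_eq_sum_left _ _ {i}, Finset.sum_singleton]
  · by_cases h : k = i
    · subst h
      simp [diagUnit]
    · simp [diagUnit, h, Ne.symm h]
  · intro k l hkl
    by_contra h
    refine hkl (Matrix.single_apply_of_ne _ _ _ _ _ ?_)
    rintro ⟨rfl, rfl⟩
    simp at h

open Classical in
theorem mul_diagUnit_apply (i : ι) (a : A) (B : FinSuppMatrix ι A) (j k : ι) :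
    (B * diagUnit i a).1 j k = if k = i then B.1 j i * a else 0 := by
  rw [coe_mul, mulEntry_eq_sum_right _ _ {i}, Finset.sum_singleton]
  · by_cases h : k = i
    · subst h
      simp [diagUnit]
    · simp [diagUnit, h, Ne.symm h]
  · intro k l hkl
    by_contra h
    refine hkl (Matrix.single_apply_of_ne _ _ _ _ _ ?_)
    rintro ⟨rfl, rfl⟩
    simp at h

/-- The entry of a matrix at a fixed position, as an additive map. -/
def entry (i j : ι) : FinSuppMatrix ι A →+ A where
  toFun B := B.1 i j
  map_zero' := rfl
  map_add' _ _ := rfl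

theorem entry_apply (i j : ι) (B : FinSuppMatrix ι A) : entry i j B = B.1 i j := rfl

theorem exists_entry_ne_zero {B : FinSuppMatrix ι A} (hB : B ≠ 0) : ∃ i j, entry i j B ≠ 0 := by
  by_contra! h
  exact hB (Subtype.ext (Matrix.ext h))

/-- The entries at a fixed position of the members of a minimal left ideal form a minimal left
ideal. -/
theorem exists_isMinimalLeftIdeal {I : AddSubgroup (FinSuppMatrix ι A)}
    (hI : IsMinimalLeftIdeal I) : ∃ J : AddSubgroup A, IsMinimalLeftIdeal J := by
  obtain ⟨B, hB, hB0⟩ := hI.exists_ne_zero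
  obtain ⟨i, j, hij⟩ := exists_entry_ne_zero hB0
  refine ⟨I.map (entry i j), ⟨?_, fun h => hij ?_⟩, ?_⟩
  · rintro a _ ⟨C, hC, rfl⟩
    exact ⟨diagUnit i a * C, hI.1.1 _ _ hC, by simp [entry_apply, diagUnit_mul_apply]⟩
  · have : entry i j B ∈ I.map (entry i j) := ⟨B, hB, rfl⟩
    simpa [h] using this
  · rintro J ⟨hJ, hJ0⟩ hJI
    obtain ⟨y, hy, hy0⟩ : ∃ y ∈ J, y ≠ 0 := by
      by_contra! h
      exact hJ0 ((AddSubgroup.eq_bot_iff_forall J).2 h)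
    obtain ⟨C, hC, rfl⟩ := hJI hy
    -- The members of `I` whose whole column `j` lies in `J` form a left ideal. Cutting `C` down to
    -- its row `i` gives a nonzero member, so this ideal is all of `I`.
    have hle := hI.le_of_mem (J := I ⊓ ⨅ k, J.comap (entry k j)) (x := diagUnit i 1 * C)
      ?_ inf_le_left ?_ ?_
    · rintro _ ⟨D, hD, rfl⟩
      exact AddSubgroup.mem_iInf.1 (hle hD).2 i
    · rintro D E ⟨hE, hEJ⟩
      refine ⟨hI.1.1 _ _ hE, AddSubgroup.mem_iInf.2 fun k => ?_⟩
      obtain ⟨s, hs⟩ := exists_finset D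
      change mulEntry D.1 E.1 k j ∈ J
      rw [mulEntry_eq_sum_left _ _ s hs]
      exact sum_mem fun l _ => hJ _ _ (AddSubgroup.mem_iInf.1 hEJ l)
    · refine ⟨hI.1.1 _ _ hC, AddSubgroup.mem_iInf.2 fun k => ?_⟩
      change (diagUnit i 1 * C).1 k j ∈ J
      rw [diagUnit_mul_apply]
      split_ifs
      · rwa [one_mul]
      · exact zero_mem J
    · intro h0
      apply hy0
      have := congrArg (entry i j) h0
      simpa [entry_apply, diagUnit_mul_apply] using this

/-- The entries at a fixed position of the members of a minimal right ideal form a minimal right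
ideal. -/
theorem exists_isMinimalRightIdeal {I : AddSubgroup (FinSuppMatrix ι A)}
    (hI : IsMinimalRightIdeal I) : ∃ J : AddSubgroup A, IsMinimalRightIdeal J := by
  obtain ⟨B, hB, hB0⟩ := hI.exists_ne_zero
  obtain ⟨i, j, hij⟩ := exists_entry_ne_zero hB0
  refine ⟨I.map (entry i j), ⟨?_, fun h => hij ?_⟩, ?_⟩
  · rintro a _ ⟨C, hC, rfl⟩
    exact ⟨C * diagUnit j a, hI.1.1 _ _ hC, by simp [entry_apply, mul_diagUnit_apply]⟩
  · have : entry i j B ∈ I.map (entry i j) := ⟨B, hB, rfl⟩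
    simpa [h] using this
  · rintro J ⟨hJ, hJ0⟩ hJI
    obtain ⟨y, hy, hy0⟩ : ∃ y ∈ J, y ≠ 0 := by
      by_contra! h
      exact hJ0 ((AddSubgroup.eq_bot_iff_forall J).2 h)
    obtain ⟨C, hC, rfl⟩ := hJI hy
    -- The dual choice: row `i` must lie in `J`, and `C` is cut down to its column `j`.
    have hle := hI.le_of_mem (J := I ⊓ ⨅ k, J.comap (entry i k)) (x := C * diagUnit j 1)
      ?_ inf_le_left ?_ ?_
    · rintro _ ⟨D, hD, rfl⟩
      exact AddSubgroup.mem_iInf.1 (hle hD).2 j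
    · rintro D E ⟨hE, hEJ⟩
      refine ⟨hI.1.1 _ _ hE, AddSubgroup.mem_iInf.2 fun k => ?_⟩
      obtain ⟨s, hs⟩ := exists_finset D
      change mulEntry E.1 D.1 i k ∈ J
      rw [mulEntry_eq_sum_right _ _ s hs]
      exact sum_mem fun l _ => hJ _ _ (AddSubgroup.mem_iInf.1 hEJ l)
    · refine ⟨hI.1.1 _ _ hC, AddSubgroup.mem_iInf.2 fun k => ?_⟩
      change (C * diagUnit j 1).1 i k ∈ J
      rw [mul_diagUnit_apply]
      split_ifs
      · rwa [mul_one]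
      · exact zero_mem J
    · intro h0
      apply hy0
      have := congrArg (entry i j) h0
      simpa [entry_apply, mul_diagUnit_apply] using this

end FinSuppMatrix

/-! ### The Leavitt algebra of a rose -/

namespace LeavittPathAlgebra

variable {K : Type*} [Field K] {E : DirectedGraph}

theorem mk_eq_of_rel {x y : FreeLeavittAlgebra K E} (h : LeavittRel K E x y) :
    mk K E x = mk K E y :=
  Quotient.sound (RingConGen.Rel.of _ _ ⟨1, x, y, h, (one_smul _ _).symm, (one_smul _ _).symm⟩)

/-- A homomorphism of `K`-algebras that respects the defining relations descends to the Leavitt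
path algebra. -/
noncomputable def lift {B : Type*} [Ring B] [Algebra K B] (f : FreeLeavittAlgebra K E →ₙₐ[K] B)
    (hf : ∀ x y, LeavittRel K E x y → f x = f y) : LeavittPathAlgebra K E →ₙₐ[K] B where
  toFun := Quotient.lift f fun x y h => by
    change RingConGen.Rel _ _ _ at h
    induction h with
    | of x y h =>
      obtain ⟨c, a, b, hab, rfl, rfl⟩ := h
      rw [map_smul, map_smul, hf a b hab]
    | refl x => rfl
    | symm _ ih => exact ih.symm
    | trans _ _ ih₁ ih₂ => exact ih₁.trans ih₂
    | add _ _ ih₁ ih₂ => rw [map_add, map_add, ih₁, ih₂]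
    | mul _ _ ih₁ ih₂ => rw [map_mul, map_mul, ih₁, ih₂]
  map_smul' c x := by
    obtain ⟨x, rfl⟩ := mk_surjective K E x
    exact map_smul f c x
  map_zero' := map_zero f
  map_add' x y := by
    obtain ⟨x, rfl⟩ := mk_surjective K E x
    obtain ⟨y, rfl⟩ := mk_surjective K E y
    exact map_add f x y
  map_mul' x y := by
    obtain ⟨x, rfl⟩ := mk_surjective K E x
    obtain ⟨y, rfl⟩ := mk_surjective K E y
    exact map_mul f x y

/-- Induction over the Leavitt path algebra along left multiplication by generators. -/
theorem induction_left {p : LeavittPathAlgebra K E → Prop} (x : LeavittPathAlgebra K E)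
    (zero : p 0) (add : ∀ x y, p x → p y → p (x + y)) (smul : ∀ (c : K) x, p x → p (c • x))
    (gen : ∀ g, p (mk K E (FreeLeavittAlgebra.gen K g)))
    (mul : ∀ g x, p x → p (mk K E (FreeLeavittAlgebra.gen K g) * x)) : p x := by
  obtain ⟨x, rfl⟩ := mk_surjective K E x
  induction x using MonoidAlgebra.induction_linear with
  | zero => rwa [map_zero]
  | add x y hx hy => rw [map_add]; exact add _ _ hx hy
  | single w c =>
    rw [← mul_one c, ← smul_eq_mul, ← MonoidAlgebra.smul_single, mk_smul]
    apply smul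
    induction w using FreeSemigroup.recOnMul with
    | ih1 g => exact gen g
    | ih2 g w _ hw =>
      rw [← mul_one (1 : K), ← MonoidAlgebra.single_mul_single, map_mul]
      exact mul _ _ hw

end LeavittPathAlgebra

namespace LeavittAlgebra

variable (K : Type*) [Field K] (n : ℕ∞)

open LeavittPathAlgebra

/-- The vertex of the rose. -/
noncomputable def unit : LeavittAlgebra K n := mk K _ (FreeLeavittAlgebra.vertex K ())

/-- The loops of the rose. -/
noncomputable def edge (i : InitialSegment n) : LeavittAlgebra K n :=
  mk K (roseGraph n) (FreeLeavittAlgebra.edge (E := roseGraph n) K i)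

/-- The ghost loops of the rose. -/
noncomputable def ghost (i : InitialSegment n) : LeavittAlgebra K n :=
  mk K (roseGraph n) (FreeLeavittAlgebra.ghost (E := roseGraph n) K i)

variable {K n}

theorem unit_mul_unit : unit K n * unit K n = unit K n :=
  mk_eq_of_rel (.vertex_mul_self (E := roseGraph n) ())

theorem unit_mul_edge (i : InitialSegment n) : unit K n * edge K n i = edge K n i :=
  mk_eq_of_rel (.source_mul_edge (E := roseGraph n) i)

theorem edge_mul_unit (i : InitialSegment n) : edge K n i * unit K n = edge K n i :=
  mk_eq_of_rel (.edge_mul_range (E := roseGraph n) i)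

theorem unit_mul_ghost (i : InitialSegment n) : unit K n * ghost K n i = ghost K n i :=
  mk_eq_of_rel (.range_mul_ghost (E := roseGraph n) i)

theorem ghost_mul_unit (i : InitialSegment n) : ghost K n i * unit K n = ghost K n i :=
  mk_eq_of_rel (.ghost_mul_source (E := roseGraph n) i)

theorem unit_mul (x : LeavittAlgebra K n) : unit K n * x = x := by
  have hg (g : LeavittGenerator (roseGraph n)) : unit K n * mk K _ (FreeLeavittAlgebra.gen K g) =
      mk K _ (FreeLeavittAlgebra.gen K g) := by
    cases g with
    | vertex v => exact unit_mul_unit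
    | edge i => exact unit_mul_edge i
    | ghost i => exact unit_mul_ghost i
  induction x using induction_left with
  | zero => rw [mul_zero]
  | add x y hx hy => rw [mul_add, hx, hy]
  | smul c x hx => rw [mul_smul_comm, hx]
  | gen g => exact hg g
  | mul g x hx => rw [← mul_assoc, hg]

theorem mul_unit (x : LeavittAlgebra K n) : x * unit K n = x := by
  induction x using induction_left with
  | zero => rw [zero_mul]
  | add x y hx hy => rw [add_mul, hx, hy]
  | smul c x hx => rw [smul_mul_assoc, hx]
  | gen g =>
    cases g with
    | vertex v => exact unit_mul_unit
    | edge i => exact edge_mul_unit i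
    | ghost i => exact ghost_mul_unit i
  | mul g x hx => rw [mul_assoc, hx]

noncomputable instance instRing : Ring (LeavittAlgebra K n) :=
  { LeavittPathAlgebra.instNonUnitalRing K (roseGraph n) with
    one := unit K n
    one_mul := unit_mul
    mul_one := mul_unit }

noncomputable instance instAlgebra : Algebra K (LeavittAlgebra K n) :=
  Algebra.ofModule smul_mul_assoc mul_smul_comm

theorem isRoseFamily [Nonempty (InitialSegment n)] :
    IsRoseFamily K (edge K n) (ghost K n) where
  ghost_mul_edge_self i := mk_eq_of_rel (.ghost_mul_edge_self (E := roseGraph n) i)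
  ghost_mul_edge_of_ne i j hij :=
    (mk_eq_of_rel (.ghost_mul_edge_of_ne (E := roseGraph n) i j hij)).trans (map_zero _)
  sum_eq_one {_} := by
    -- The finiteness instance and the existence of a petal make the vertex regular, so its sum
    -- relation is available.
    have hreg : (roseGraph n).IsRegular () :=
      ⟨Set.finite_univ (α := InitialSegment n) |>.subset fun _ _ => trivial,
        ‹Nonempty (InitialSegment n)›.elim fun i => ⟨i, rfl⟩⟩
    have hsum := mk_eq_of_rel (LeavittRel.vertex_eq_sum (K := K) (E := roseGraph n) () hreg)
    rw [map_sum] at hsum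
    refine Eq.trans (Finset.sum_congr ?_ fun _ _ => rfl) hsum.symm
    ext i
    exact iff_of_true (Finset.mem_univ _) ((Set.Finite.mem_toFinset _).2 rfl)
  adjoin_eq_top := by
    refine Algebra.eq_top_iff.2 fun x => ?_
    have hg (g : LeavittGenerator (roseGraph n)) : mk K _ (FreeLeavittAlgebra.gen K g) ∈
        Algebra.adjoin K (Set.range (edge K n) ∪ Set.range (ghost K n)) := by
      cases g with
      | vertex v => exact one_mem (Algebra.adjoin K _)
      | edge i => exact Algebra.subset_adjoin (.inl ⟨i, rfl⟩)
      | ghost i => exact Algebra.subset_adjoin (.inr ⟨i, rfl⟩)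
    induction x using induction_left with
    | zero => exact zero_mem (Algebra.adjoin K _)
    | add x y hx hy => exact add_mem hx hy
    | smul c x hx => exact Subalgebra.smul_mem _ hx c
    | gen g => exact hg g
    | mul g x hx => exact mul_mem (hg g) hx

/-! ### One petal -/

open LaurentPolynomial in
/-- The values of the generators in the Laurent polynomials. -/
noncomputable def laurentGenerator (K : Type*) [Field K] {n : ℕ∞} :
    LeavittGenerator (roseGraph n) → LaurentPolynomial K
  | .vertex _ => 1
  | .edge _ => T 1
  | .ghost _ => T (-1)

/-- The map from the free algebra to the Laurent polynomials. -/
noncomputable def freeToLaurent (K : Type*) [Field K] (n : ℕ∞) :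
    FreeLeavittAlgebra K (roseGraph n) →ₙₐ[K] LaurentPolynomial K :=
  MonoidAlgebra.liftMagma K (FreeSemigroup.lift (laurentGenerator K))

theorem freeToLaurent_gen (g : LeavittGenerator (roseGraph n)) :
    freeToLaurent K n (FreeLeavittAlgebra.gen K g) = laurentGenerator K g := by
  simp [freeToLaurent, FreeLeavittAlgebra.gen, MonoidAlgebra.liftMagma]

open LaurentPolynomial in
theorem freeToLaurent_rel [Subsingleton (InitialSegment n)]
    (x y : FreeLeavittAlgebra K (roseGraph n)) (h : LeavittRel K (roseGraph n) x y) :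
    freeToLaurent K n x = freeToLaurent K n y := by
  have : Subsingleton (roseGraph n).Edge := ‹Subsingleton (InitialSegment n)›
  have hT : (T 1 * T (-1) : LaurentPolynomial K) = 1 := by rw [← T_add]; simp
  have hT' : (T (-1) * T 1 : LaurentPolynomial K) = 1 := by rw [← T_add]; simp
  cases h with
  | vertex_mul_of_ne v w h => exact absurd rfl h
  | ghost_mul_edge_of_ne e f h => exact absurd (Subsingleton.elim e f) h
  | vertex_eq_sum v h =>
    obtain ⟨i, hi⟩ := h.2
    rw [Finset.sum_eq_single i (fun j _ hj => absurd (Subsingleton.elim j i) hj)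
      fun hn => absurd (h.1.mem_toFinset.2 hi) hn]
    simp [FreeLeavittAlgebra.vertex, FreeLeavittAlgebra.edge, FreeLeavittAlgebra.ghost,
      freeToLaurent_gen, laurentGenerator, hT]
  | _ =>
    simp [FreeLeavittAlgebra.vertex, FreeLeavittAlgebra.edge, FreeLeavittAlgebra.ghost,
      freeToLaurent_gen, laurentGenerator, hT']

/-- The homomorphism from `L_K(1,1)` to the Laurent polynomials. -/
noncomputable def toLaurent (K : Type*) [Field K] (n : ℕ∞) [Subsingleton (InitialSegment n)] :
    LeavittAlgebra K n →ₐ[K] LaurentPolynomial K :=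
  AlgHom.ofLinearMap
    (LeavittPathAlgebra.lift (freeToLaurent K n) freeToLaurent_rel :
      LeavittAlgebra K n →ₙₐ[K] LaurentPolynomial K)
    (freeToLaurent_gen (.vertex ()))
    (map_mul (LeavittPathAlgebra.lift (freeToLaurent K n) freeToLaurent_rel))

open LaurentPolynomial in
theorem toLaurent_edge [Subsingleton (InitialSegment n)] (i : InitialSegment n) :
    toLaurent K n (edge K n i) = T 1 :=
  freeToLaurent_gen (.edge i)

/-- With one petal, the loop is a unit. -/
noncomputable def edgeUnit (K : Type*) [Field K] {n : ℕ∞} [Subsingleton (InitialSegment n)]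
    (i : InitialSegment n) : (LeavittAlgebra K n)ˣ :=
  have : Nonempty (InitialSegment n) := ⟨i⟩
  { val := edge K n i
    inv := ghost K n i
    val_inv := by
      let _ : Unique (InitialSegment n) := ⟨⟨i⟩, fun _ => Subsingleton.elim _ _⟩
      have := (isRoseFamily (K := K) (n := n)).sum_eq_one
      rwa [Fintype.sum_unique] at this
    inv_val := isRoseFamily.ghost_mul_edge_self i }

/-- The homomorphism from the Laurent polynomials to `L_K(1,1)`. -/
noncomputable def ofLaurent (K : Type*) [Field K] {n : ℕ∞} [Subsingleton (InitialSegment n)]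
    (i : InitialSegment n) : LaurentPolynomial K →ₐ[K] LeavittAlgebra K n :=
  AddMonoidAlgebra.lift K _ ℤ ((Units.coeHom _).comp (zpowersHom _ (edgeUnit K i)))

open LaurentPolynomial in
theorem ofLaurent_T [Subsingleton (InitialSegment n)] (i : InitialSegment n) (k : ℤ) :
    ofLaurent K i (T k) = ((edgeUnit K i ^ k : (LeavittAlgebra K n)ˣ) : LeavittAlgebra K n) := by
  refine (AddMonoidAlgebra.lift_single _ _ _).trans ?_
  rw [one_smul]
  rfl

open LaurentPolynomial in
-- This gives injectivity of `ofLaurent`: the relations of the one-petal rose do not collapse the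
-- Laurent polynomials. Checking at `T 1` suffices, since it generates the group of monomials.
theorem toLaurent_ofLaurent [Subsingleton (InitialSegment n)] (i : InitialSegment n)
    (p : LaurentPolynomial K) : toLaurent K n (ofLaurent K i p) = p := by
  suffices (toLaurent K n).comp (ofLaurent K i) = AlgHom.id K _ from DFunLike.congr_fun this p
  apply AddMonoidAlgebra.algHom_ext'
  · apply MonoidHom.ext_mint
    change toLaurent K n (ofLaurent K i (T 1)) = T 1
    rw [ofLaurent_T, zpow_one]
    exact toLaurent_edge i
  · exact Subsingleton.elim _ _

open LaurentPolynomial in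
theorem ofLaurent_surjective [Subsingleton (InitialSegment n)] (i : InitialSegment n) :
    Function.Surjective (ofLaurent K i) := by
  have : Nonempty (InitialSegment n) := ⟨i⟩
  rw [← AlgHom.range_eq_top, eq_top_iff, ← isRoseFamily.adjoin_eq_top, Algebra.adjoin_le_iff]
  rintro _ (⟨j, rfl⟩ | ⟨j, rfl⟩) <;> obtain rfl := Subsingleton.elim i j
  · exact ⟨T 1, (ofLaurent_T i 1).trans (by rw [zpow_one]; rfl)⟩
  · exact ⟨T (-1), (ofLaurent_T i (-1)).trans (by rw [zpow_neg_one]; rfl)⟩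

/-- `L_K(1,1)` is the algebra of Laurent polynomials. -/
noncomputable def laurentEquiv (K : Type*) [Field K] {n : ℕ∞} [Subsingleton (InitialSegment n)]
    (i : InitialSegment n) : LaurentPolynomial K ≃ₐ[K] LeavittAlgebra K n :=
  AlgEquiv.ofBijective (ofLaurent K i)
    ⟨Function.LeftInverse.injective (toLaurent_ofLaurent i), ofLaurent_surjective i⟩

open LaurentPolynomial in
-- Evaluation at the unit `-1` sends the element to `0`.
theorem laurent_not_isUnit (K : Type*) [Field K] : ¬ IsUnit (T 1 + 1 : LaurentPolynomial K) := by
  intro h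
  have := h.map (LaurentPolynomial.eval₂ (RingHom.id K) (-1 : Kˣ))
  rw [map_add, eval₂_T, map_one] at this
  simp at this

open LaurentPolynomial in
theorem laurent_ne_zero (K : Type*) [Field K] : (T 1 + 1 : LaurentPolynomial K) ≠ 0 := by
  intro h
  have := congrArg (fun p => p.coeff 1) h
  -- Writing the constant as `T 0` shows that the coefficient at exponent `1` comes from `T 1`
  -- alone.
  rw [← T_zero] at this
  simp [-T_zero] at this

/-- The Leavitt algebra has no minimal one-sided ideals. -/
theorem not_isMinimal [Nonempty (InitialSegment n)] (I : AddSubgroup (LeavittAlgebra K n)) :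
    ¬ IsMinimalLeftIdeal I ∧ ¬ IsMinimalRightIdeal I := by
  cases subsingleton_or_nontrivial (InitialSegment n) with
  | inl _ =>
    obtain ⟨i⟩ := ‹Nonempty (InitialSegment n)›
    let φ := laurentEquiv K i
    have : IsDomain (LeavittAlgebra K n) := φ.symm.toMulEquiv.isDomain _
    have ht : φ (LaurentPolynomial.T 1 + 1) ≠ 0 := by
      rw [Ne, map_eq_zero_iff φ φ.injective]
      exact laurent_ne_zero K
    have hu (r : LeavittAlgebra K n) : r * φ (LaurentPolynomial.T 1 + 1) ≠ 1 := by
      intro h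
      have h' := congrArg φ.symm h
      rw [map_mul, AlgEquiv.symm_apply_apply, map_one] at h'
      exact laurent_not_isUnit K (IsUnit.of_mul_eq_one_right _ h')
    refine ⟨not_isMinimalLeftIdeal_of_domain ht hu I,
      not_isMinimalRightIdeal_of_domain ht (fun r h => hu r ?_) I⟩
    -- In a domain a right inverse is also a left inverse.
    exact mul_eq_one_symm h
  | inr _ =>
    have hfam := isRoseFamily (K := K) (n := n)
    obtain ⟨i, j, hij⟩ := exists_pair_ne (InitialSegment n)
    -- The zero ring has no nonzero ideals; otherwise `s k * e k = 1` makes the generators nonzero.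
    cases subsingleton_or_nontrivial (LeavittAlgebra K n) with
    | inl _ =>
      exact ⟨fun h => h.exists_ne_zero.elim fun x hx => hx.2 (Subsingleton.elim _ _),
        fun h => h.exists_ne_zero.elim fun x hx => hx.2 (Subsingleton.elim _ _)⟩
    | inr _ =>
      have hs (k) : ghost K n k ≠ 0 := left_ne_zero_of_mul_eq_one (hfam.ghost_mul_edge_self k)
      have he (k) : edge K n k ≠ 0 := right_ne_zero_of_mul_eq_one (hfam.ghost_mul_edge_self k)
      have hA (x : LeavittAlgebra K n) (hx : x ≠ 0) := hfam.exists_mul_mul_eq_one hx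
      exact ⟨not_isMinimalLeftIdeal_of_carry hA (hs i) (he j) (hfam.ghost_mul_edge_of_ne i j hij) I,
        not_isMinimalRightIdeal_of_carry hA (hs i) (he j) (hfam.ghost_mul_edge_of_ne i j hij) I⟩

end LeavittAlgebra

theorem mainTheorem12 (K : Type*) [Field K] (m n : ℕ∞) (hn : 1 ≤ n) :
    leftSocle (MatrixRing m (LeavittAlgebra K n)) = ⊥ ∧
      rightSocle (MatrixRing m (LeavittAlgebra K n)) = ⊥ := by
  have : Nonempty (InitialSegment n) := ⟨⟨0, by simpa using one_pos.trans_le hn⟩⟩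
  refine ⟨leftSocle_eq_bot fun I hI => ?_, rightSocle_eq_bot fun I hI => ?_⟩
  · obtain ⟨J, hJ⟩ := FinSuppMatrix.exists_isMinimalLeftIdeal hI
    exact (LeavittAlgebra.not_isMinimal J).1 hJ
  · obtain ⟨J, hJ⟩ := FinSuppMatrix.exists_isMinimalRightIdeal hI
    exact (LeavittAlgebra.not_isMinimal J).2 hJ
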